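/- Let $G=H_1*\dots*H_q*F_r$ be a free product decomposition of a group $G$ with all $H_i\le G$ nontrivial, $q\ge 0$, and $F_r$ free of finite rank $r>0$. The trees in the outer space $\mathcal O=\mathcal O(G,(H_i)_{i=1}^q,F_r)$ are the simplicial metric trees $T$ with an isometric simplicial action of $G$ without inversions such that: the action is minimal and $G\backslash T$ is a finite graph; edge stabilisers are trivial; for each $i$ there is exactly one vertex with stabiliser $H_i$; and every vertex which is not in the $G$-orbit of one of these has trivial stabiliser. (Points of $\mathcal O$ are such trees up to $G$-equivariant homothety.) An $\mathcal O$-map $f:A\to B$ between two such trees is a $G$-equivariant, Lipschitz, surjective map. For a path $\gamma$ in a tree, $[\gamma]$ denotes the path obtained by pulling $\gamma$ tight, that is, the unique geodesic (possibly constant) path homotopic to $\gamma$ relative to the endpoints. **Theorem.** Let $A,B$ be trees in $\mathcal O$ and let $f,h:A\to B$ be $\mathcal O$-maps. Then there is a constant $C>0$, depending only on $f$, $h$ and $A$, such that for every path $L:[0,1]\to A$ the paths $[f(L)]$ and $[h(L)]$ are equal, except possibly for initial and terminal subpaths of length at most $C$. Precisely, up to reparametrisation, either $[f(L)]=\alpha\cdot\mu\cdot\beta$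 and $[h(L)]=\alpha'\cdot\mu\cdot\beta'$ with a common (possibly degenerate) subpath $\mu$ and with $\alpha,\beta,\alpha',\beta'$ of length at most $C$; or each of $[f(L)]$ and $[h(L)]$ is covered by an initial and a terminal subpath of length at most $C$. -/

import Mathlib

open scoped unitInterval NNReal

universe u v w

namespace RelOuterSpace

/-! ### Real trees, lengths of paths and tightening -/

/-- The geodesic segment `[x, y]`. -/
def seg {T : Type*} [MetricSpace T] (x y : T) : Set T :=
  {z | dist x z + dist z y = dist x y}

/-- A path parametrised proportionally to arc length whose length is the distance of its
endpoints, i.e. a (rescaled) isometric immersion of an interval. -/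
def IsGeodesicPath {T : Type*} [MetricSpace T] {x y : T} (ρ : Path x y) : Prop :=
  ∀ s t : I, dist (ρ s) (ρ t) = dist x y * |(s : ℝ) - t|

/-- Real trees: nonempty geodesic metric spaces that are `0`-hyperbolic (four point condition). -/
class IsRTree (T : Type*) [MetricSpace T] : Prop where
  nonempty : Nonempty T
  exists_geodesic : ∀ x y : T, ∃ ρ : Path x y, IsGeodesicPath ρ
  four_point : ∀ x y z w : T,
    dist x y + dist z w ≤ max (dist x z + dist y w) (dist x w + dist y z)

/-- The length of a path, as its total variation. -/
noncomputable def pathLength {T : Type*} [MetricSpace T] {x y : T} (γ : Path x y) : ENNReal :=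
  eVariationOn γ Set.univ

/-- `ρ` is obtained from `γ` by pulling tight: it is a geodesic homotopic to `γ` relative to the
endpoints. -/
def IsTightening {T : Type*} [MetricSpace T] {x y : T} (γ ρ : Path x y) : Prop :=
  γ.Homotopic ρ ∧ IsGeodesicPath ρ

/-- Two points at the same proportion of two geodesics issuing from the same point. -/
theorem dist_le_of_proportional {T : Type*} [MetricSpace T] [IsRTree T] {o z w p q : T} {s : ℝ}
    (hs0 : 0 ≤ s) (hs1 : s ≤ 1)
    (hp : dist o p = s * dist o z) (hp' : dist p z = (1 - s) * dist o z)
    (hq : dist o q = s * dist o w) (hq' : dist q w = (1 - s) * dist o w) :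
    dist p q ≤ dist z w := by
  have h1 := IsRTree.four_point o z p q
  have h2 := IsRTree.four_point o w q z
  have t1 := dist_triangle o z w
  have t2 := dist_triangle o w z
  have e1 := dist_comm z w
  have e2 := dist_comm p z
  have e3 := dist_comm q w
  have e4 := dist_comm q z
  have e5 := dist_comm p q
  have m1 : s * dist o z ≤ s * (dist o w + dist z w) :=
    mul_le_mul_of_nonneg_left (by linarith) hs0
  have m2 : s * dist o w ≤ s * (dist o z + dist z w) :=
    mul_le_mul_of_nonneg_left (by linarith) hs0
  have m3 : (1 - s) * dist o z ≤ (1 - s) * (dist o w + dist z w) :=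
    mul_le_mul_of_nonneg_left (by linarith) (by linarith)
  have m4 : (1 - s) * dist o w ≤ (1 - s) * (dist o z + dist z w) :=
    mul_le_mul_of_nonneg_left (by linarith) (by linarith)
  have m5 : 0 ≤ s * dist z w := mul_nonneg hs0 dist_nonneg
  have m6 : 0 ≤ (1 - s) * dist z w := mul_nonneg (by linarith) dist_nonneg
  have m7 : 0 ≤ (1 - s) * dist o z := mul_nonneg (by linarith) dist_nonneg
  have m8 : 0 ≤ (1 - s) * dist o w := mul_nonneg (by linarith) dist_nonneg
  rcases le_max_iff.1 h1 with h1 | h1 <;> rcases le_max_iff.1 h2 with h2 | h2 <;> nlinarith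

theorem IsGeodesicPath.dist_left {T : Type*} [MetricSpace T] {x y : T} {ρ : Path x y}
    (h : IsGeodesicPath ρ) (s : I) : dist x (ρ s) = s * dist x y := by
  have := h 0 s
  rw [Path.source] at this
  rw [this, Set.Icc.coe_zero, zero_sub, abs_neg, abs_of_nonneg s.2.1, mul_comm]

theorem IsGeodesicPath.dist_right {T : Type*} [MetricSpace T] {x y : T} {ρ : Path x y}
    (h : IsGeodesicPath ρ) (s : I) : dist (ρ s) y = (1 - s) * dist x y := by
  have := h s 1
  rw [Path.target] at this
  rw [this, Set.Icc.coe_one, abs_sub_comm, abs_of_nonneg (sub_nonneg.2 s.2.2), mul_comm]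

theorem contractibleSpace (T : Type*) [MetricSpace T] [IsRTree T] : ContractibleSpace T := by
  obtain ⟨o⟩ := IsRTree.nonempty (T := T)
  choose ρ hρ using fun z : T => IsRTree.exists_geodesic o z
  have hc : Continuous fun a : I × T => ρ a.2 a.1 := by
    rw [continuous_iff_continuousAt]
    rintro ⟨s₀, z₀⟩
    unfold ContinuousAt
    rw [tendsto_iff_dist_tendsto_zero]
    have hlim : Filter.Tendsto (fun a : I × T => dist a.2 z₀ + dist (ρ z₀ a.1) (ρ z₀ s₀))
        (nhds (s₀, z₀)) (nhds 0) := by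
      have : Continuous fun a : I × T => dist a.2 z₀ + dist (ρ z₀ a.1) (ρ z₀ s₀) := by fun_prop
      have h := this.tendsto (s₀, z₀)
      simpa using h
    refine squeeze_zero (fun _ => dist_nonneg) (fun a => ?_) hlim
    refine (dist_triangle _ (ρ z₀ a.1) _).trans (add_le_add_left ?_ _)
    exact dist_le_of_proportional a.1.2.1 a.1.2.2 ((hρ a.2).dist_left a.1)
      ((hρ a.2).dist_right a.1) ((hρ z₀).dist_left a.1) ((hρ z₀).dist_right a.1)
  rw [contractible_iff_id_nullhomotopic]
  exact ⟨o, ⟨ContinuousMap.Homotopy.symm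
    { toFun := fun a => ρ a.2 a.1
      continuous_toFun := hc
      map_zero_left := fun z => by simp
      map_one_left := fun z => by simp }⟩⟩

/-- In a real tree every path has exactly one tightening. -/
theorem existsUnique_isTightening {T : Type*} [MetricSpace T] [IsRTree T] {x y : T}
    (γ : Path x y) : ∃! ρ : Path x y, IsTightening γ ρ := by
  have := contractibleSpace T
  obtain ⟨ρ, hρ⟩ := IsRTree.exists_geodesic x y
  refine ⟨ρ, ⟨SimplyConnectedSpace.paths_homotopic γ ρ, hρ⟩, ?_⟩
  rintro τ ⟨-, hτ⟩
  ext s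
  have := dist_le_of_proportional s.2.1 s.2.2 (hτ.dist_left s) (hτ.dist_right s)
    (hρ.dist_left s) (hρ.dist_right s)
  rw [dist_self] at this
  exact dist_le_zero.1 this

/-- The tightened path `[γ]`: the unique geodesic homotopic to `γ` relative to the endpoints. -/
noncomputable def tighten {T : Type*} [MetricSpace T] [IsRTree T] {x y : T}
    (γ : Path x y) : Path x y :=
  (existsUnique_isTightening γ).choose

theorem isTightening_tighten {T : Type*} [MetricSpace T] [IsRTree T] {x y : T}
    (γ : Path x y) : IsTightening γ (tighten γ) :=
  (existsUnique_isTightening γ).choose_spec.1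

/-- The paths `ρ` and `τ` (parametrised proportionally to arc length) are equal, except possibly
for initial and terminal subpaths of length at most `C`. Either there are decompositions
`ρ = α · μ · β` and `τ = α' · μ' · β'` with `μ = μ'` and with `α, β, α', β'` of length at most `C`,
or the exceptional subpaths `α, β` and `α', β'` already cover the whole of `ρ` and of `τ`. -/
def EqualExceptNearEnds {T : Type*} [MetricSpace T] {x y x' y' : T} (C : ℝ)
    (ρ : Path x y) (τ : Path x' y') : Prop :=
  ∃ a b a' b' : I,
    pathLength (ρ.subpath 0 a) ≤ ENNReal.ofReal C ∧
    pathLength (ρ.subpath b 1) ≤ ENNReal.ofReal C ∧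
    pathLength (τ.subpath 0 a') ≤ ENNReal.ofReal C ∧
    pathLength (τ.subpath b' 1) ≤ ENNReal.ofReal C ∧
    ((a ≤ b ∧ a' ≤ b' ∧ ∀ t : I, ρ.subpath a b t = τ.subpath a' b' t) ∨ (b ≤ a ∧ b' ≤ a'))

/-! ### Free product decompositions and the relative outer space -/

/-- `G` is the internal free product `H₁ * ⋯ * H_q * F_r` of the nontrivial subgroups `H i` and of
the free group on `b₁, …, b_r`. -/
structure IsFreeProductDecomposition {G : Type*} [Group G] {q r : ℕ} (H : Fin q → Subgroup G)
    (b : Fin r → G) : Prop where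
  nontrivial : ∀ i, H i ≠ ⊥
  bijective : Function.Bijective
    (Monoid.Coprod.lift (Monoid.CoprodI.lift fun i => (H i).subtype) (FreeGroup.lift b) :
      Monoid.Coprod (Monoid.CoprodI fun i => H i) (FreeGroup (Fin r)) →* G)

/-- `u` and `v` are the endpoints of an edge of the tree with vertex set `V`. -/
def IsEdge {T : Type*} [MetricSpace T] (V : Set T) (u v : T) : Prop :=
  u ∈ V ∧ v ∈ V ∧ u ≠ v ∧ seg u v ∩ V = {u, v}

/-- `V` makes the real tree `T` a simplicial metric tree: `V` is nonempty, every segment contains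
finitely many vertices, and every point which is not a vertex lies on exactly one edge. -/
structure IsSimplicial {T : Type*} [MetricSpace T] (V : Set T) : Prop where
  nonempty : V.Nonempty
  finite_seg : ∀ x y : T, (seg x y ∩ V).Finite
  exists_edge : ∀ x, x ∉ V → ∃ u v, IsEdge V u v ∧ x ∈ seg u v
  edge_unique : ∀ x, x ∉ V → ∀ u v u' v', IsEdge V u v → IsEdge V u' v' →
    x ∈ seg u v → x ∈ seg u' v' → ({u, v} : Set T) = {u', v'}

/-- The simplicial metric `G`-trees which represent the points of the outer space of `G` relative
to the subgroups `H₁, …, H_q`. -/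
structure OuterTree (G : Type u) [Group G] {q : ℕ} (H : Fin q → Subgroup G) where
  carrier : Type v
  [metricSpace : MetricSpace carrier]
  [isRTree : IsRTree carrier]
  [mulAction : MulAction G carrier]
  [isIsometricSMul : IsIsometricSMul G carrier]
  /-- The vertices. -/
  verts : Set carrier
  simplicial : IsSimplicial verts
  smul_verts : ∀ (g : G), ∀ v ∈ verts, g • v ∈ verts
  /-- The quotient graph is finite. -/
  finite_quotient : ∃ E : Set (carrier × carrier), E.Finite ∧
    ∀ u v, IsEdge verts u v → ∃ g : G, (g • u, g • v) ∈ E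
  /-- There is no proper nonempty invariant subtree. -/
  minimal : ∀ S : Set carrier, S.Nonempty → (∀ x ∈ S, ∀ y ∈ S, seg x y ⊆ S) →
    (∀ (g : G), ∀ x ∈ S, g • x ∈ S) → S = Set.univ
  /-- Edge stabilisers are trivial and no edge is inverted. -/
  edge_stabilizer : ∀ x, x ∉ verts → MulAction.stabilizer G x = ⊥
  /-- Exactly one vertex has stabiliser `H i`. -/
  nonfree : ∀ i, ∃! v, v ∈ verts ∧ MulAction.stabilizer G v = H i
  /-- Outside the orbits of these vertices, vertex stabilisers are trivial. -/
  free : ∀ v ∈ verts, (∃ (i : Fin q) (g : G), MulAction.stabilizer G (g • v) = H i) ∨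
    MulAction.stabilizer G v = ⊥

attribute [instance] OuterTree.metricSpace OuterTree.isRTree OuterTree.mulAction
  OuterTree.isIsometricSMul

/-- An `𝒪`-map: a `G`-equivariant Lipschitz surjection between trees of the outer space. -/
structure OMap {G : Type u} [Group G] {q : ℕ} {H : Fin q → Subgroup G}
    (A : OuterTree.{u, v} G H) (B : OuterTree.{u, w} G H) where
  toFun : A.carrier → B.carrier
  equivariant : ∀ (g : G) (x : A.carrier), toFun (g • x) = g • toFun x
  lipschitz : ∃ K : ℝ≥0, LipschitzWith K toFun
  surjective : Function.Surjective toFun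

theorem OMap.continuous {G : Type u} [Group G] {q : ℕ} {H : Fin q → Subgroup G}
    {A : OuterTree.{u, v} G H} {B : OuterTree.{u, w} G H} (f : OMap A B) : Continuous f.toFun :=
  f.lipschitz.choose_spec.continuous

end RelOuterSpace

namespace RelOuterSpace

section RTree

variable {T : Type*} [MetricSpace T] {x y : T} {ρ : Path x y}

/-! Two facts suffice. First, `f` and `h` are uniformly close (`OMap.exists_dist_le`): by
equivariance the distance between the images of a point is constant on orbits, and finitely many
edges represent all edges up to translation. Second, geodesics of a tree whose endpoints are
`D`-close share their middle part (`IsGeodesicPath.equalExceptNearEnds`). Tightenings are geodesics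
with the endpoints of the original paths, so the second fact applies to them, whatever `L` does in
between. -/

theorem IsGeodesicPath.dist_subpath (h : IsGeodesicPath ρ) (a b s t : I) :
    dist (ρ.subpath a b s) (ρ.subpath a b t) = dist (ρ a) (ρ b) * |(s : ℝ) - t| := by
  have e : ((Set.Icc.convexComb a b s : I) : ℝ) - (Set.Icc.convexComb a b t : I)
      = (a - b) * (t - s) := by
    simp only [Set.Icc.coe_convexComb]
    ring
  change dist (ρ (Set.Icc.convexComb a b s)) (ρ (Set.Icc.convexComb a b t)) = _
  rw [h, h, e, abs_mul, abs_sub_comm (t : ℝ) s, mul_assoc]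

theorem IsGeodesicPath.subpath (h : IsGeodesicPath ρ) (a b : I) :
    IsGeodesicPath (ρ.subpath a b) :=
  h.dist_subpath a b

/-- The length of a geodesic is at most the distance of its endpoints. -/
theorem IsGeodesicPath.pathLength_le (h : IsGeodesicPath ρ) :
    pathLength ρ ≤ ENNReal.ofReal (dist x y) := by
  have hmono : MonotoneOn (fun t : I => dist x y * (t : ℝ)) Set.univ := fun s _ t _ hst =>
    mul_le_mul_of_nonneg_left hst dist_nonneg
  have hle := hmono.eVariationOn_eq (Set.mem_univ 0) (Set.mem_univ 1)
  have huniv : (Set.univ ∩ Set.Icc 0 1 : Set I) = Set.univ := by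
    rw [Set.univ_inter]
    exact Set.eq_univ_of_forall fun t => ⟨t.2.1, t.2.2⟩
  rw [huniv] at hle
  -- The geodesic has the same increments as a monotone linear function, so the two variations agree
  -- term by term.
  have heq : pathLength ρ = eVariationOn (fun t : I => dist x y * (t : ℝ)) Set.univ := by
    unfold pathLength eVariationOn
    congr 1 with p : 1
    refine Finset.sum_congr rfl fun i _ => ?_
    rw [edist_dist, edist_dist, h, Real.dist_eq, ← mul_sub, abs_mul, abs_of_nonneg dist_nonneg]
  rw [heq, hle]
  simp

theorem IsGeodesicPath.pathLength_subpath_le (h : IsGeodesicPath ρ) {a b : I} {C : ℝ}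
    (hC : dist (ρ a) (ρ b) ≤ C) : pathLength (ρ.subpath a b) ≤ ENNReal.ofReal C :=
  (h.subpath a b).pathLength_le.trans (ENNReal.ofReal_le_ofReal hC)

variable [IsRTree T]

/-- A geodesic passes through every point of the segment between its endpoints. -/
theorem IsGeodesicPath.exists_eq (h : IsGeodesicPath ρ) {m : T}
    (hm : dist x m + dist m y = dist x y) : ∃ t : I, ρ t = m := by
  have h0 : 0 ≤ dist x m := dist_nonneg
  have h1 : 0 ≤ dist m y := dist_nonneg
  rcases eq_or_ne x y with hxy | hxy
  · refine ⟨0, ?_⟩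
    have : dist x y = 0 := dist_eq_zero.2 hxy
    rw [Path.source]
    exact dist_le_zero.1 (by linarith)
  · have hpos : 0 < dist x y := dist_pos.2 hxy
    let t : I := ⟨dist x m / dist x y, by positivity, (div_le_one hpos).2 (by linarith)⟩
    have ht : dist x m = (t : ℝ) * dist x y := (div_mul_cancel₀ _ hpos.ne').symm
    have := dist_le_of_proportional t.2.1 t.2.2 (h.dist_left t) (h.dist_right t) ht
      (by linarith)
    rw [dist_self] at this
    exact ⟨t, dist_le_zero.1 this⟩

/-- A point of a segment stays on it when an endpoint is moved by no more than its distance to the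
point. -/
theorem mem_seg_of_dist_le {p p' q m : T} (hm : dist p m + dist m q = dist p q)
    (hp : dist p p' ≤ dist p m) : dist p' m + dist m q = dist p' q := by
  refine le_antisymm ?_ (dist_triangle _ _ _)
  -- The first alternative forces `p' = m`; the second is the missing inequality.
  rcases le_max_iff.1 (IsRTree.four_point p q p' m) with h | h
  · have h0 : dist p' m ≤ 0 := by linarith [dist_comm q m]
    rw [dist_le_zero.1 h0, dist_self, zero_add]
  · linarith [dist_comm q p']

/-- Geodesics with endpoints at distance at most `D` are equal except near their ends. -/
theorem IsGeodesicPath.equalExceptNearEnds {x' y' : T} {τ : Path x' y'} {D : ℝ}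
    (hρ : IsGeodesicPath ρ) (hτ : IsGeodesicPath τ) (hD : 0 < D) (hx : dist x x' ≤ D)
    (hy : dist y y' ≤ D) : EqualExceptNearEnds (6 * D) ρ τ := by
  have hτle : dist x' y' ≤ dist x y + 2 * D := by
    linarith [dist_triangle x' x y', dist_triangle x y y', dist_comm x x']
  -- A short `ρ` forces `τ` to have length at most `6 * D`, so both are exceptional throughout. Only
  -- this case needs the constant 6.
  rcases le_or_gt (dist x y) (4 * D) with hs | hl
  · have h1 : dist (ρ 0) (ρ 1) ≤ 6 * D := by
      rw [Path.source, Path.target]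
      linarith
    have h2 : dist (τ 0) (τ 1) ≤ 6 * D := by
      rw [Path.source, Path.target]
      linarith
    exact ⟨1, 0, 1, 0, hρ.pathLength_subpath_le h1, hρ.pathLength_subpath_le h1,
      hτ.pathLength_subpath_le h2, hτ.pathLength_subpath_le h2,
      Or.inr ⟨zero_le_one, zero_le_one⟩⟩
  · have hpos : 0 < dist x y := by linarith
    -- `ρ a` and `ρ b` lie at distance exactly `D` from the two ends, just deep enough to stay on
    -- the segment when the ends move by `D`.
    let a : I := ⟨D / dist x y, by positivity, (div_le_one hpos).2 (by linarith)⟩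
    let b : I := unitInterval.symm a
    have ha : (a : ℝ) * dist x y = D := div_mul_cancel₀ _ hpos.ne'
    have hb : (b : ℝ) = 1 - a := unitInterval.coe_symm_eq a
    have hxa : dist x (ρ a) = D := by rw [hρ.dist_left, ha]
    have hay : dist (ρ a) y = dist x y - D := by rw [hρ.dist_right, sub_mul, ha, one_mul]
    have hxb : dist x (ρ b) = dist x y - D := by rw [hρ.dist_left, hb, sub_mul, ha, one_mul]
    have hby : dist (ρ b) y = D := by rw [hρ.dist_right, hb, sub_sub_cancel, ha]
    have key : ∀ m, dist x m + dist m y = dist x y → D ≤ dist x m → D ≤ dist m y →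
        ∃ t, τ t = m := fun m hm h1 h2 => by
      -- Move one endpoint at a time: `x` to `x'`, then `y` to `y'`.
      have e1 := mem_seg_of_dist_le hm (hx.trans h1)
      have e2 := mem_seg_of_dist_le (p := y) (p' := y') (q := x') (m := m)
        (by rw [dist_comm y m, dist_comm m x', dist_comm y x']; linarith)
        (by rw [dist_comm y m]; linarith)
      refine hτ.exists_eq ?_
      rw [dist_comm y' m, dist_comm m x', dist_comm y' x'] at e2
      linarith
    obtain ⟨a', ha'⟩ := key (ρ a) (by linarith) (by linarith) (by linarith)
    obtain ⟨b', hb'⟩ := key (ρ b) (by linarith) (by linarith) (by linarith)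
    have hxa' : dist x' (ρ a) ≤ 2 * D := by
      linarith [dist_triangle x' x (ρ a), dist_comm x x']
    have hyb' : dist (ρ b) y' ≤ 2 * D := by linarith [dist_triangle (ρ b) y y']
    have hxb' : dist x y - 2 * D ≤ dist x' (ρ b) := by linarith [dist_triangle x x' (ρ b)]
    refine ⟨a, b, a', b', ?_, ?_, ?_, ?_, Or.inl ⟨?_, ?_, fun t => ?_⟩⟩
    · refine hρ.pathLength_subpath_le ?_
      rw [Path.source]
      linarith
    · refine hρ.pathLength_subpath_le ?_
      rw [Path.target]
      linarith
    · refine hτ.pathLength_subpath_le ?_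
      rw [Path.source, ha']
      linarith
    · refine hτ.pathLength_subpath_le ?_
      rw [Path.target, hb']
      linarith
    · rw [← Subtype.coe_le_coe]
      refine le_of_mul_le_mul_right ?_ hpos
      rw [← hρ.dist_left, ← hρ.dist_left]
      linarith
    -- `ρ a` is within `2 * D` of `x'`, and `ρ b` is farther than that because `dist x y > 4 * D`.
    · rw [← Subtype.coe_le_coe]
      refine le_of_mul_le_mul_right ?_ (show 0 < dist x' y' by
        linarith [dist_triangle x x' y, dist_triangle x' y' y, dist_comm y y'])
      rw [← hτ.dist_left, ← hτ.dist_left, ha', hb']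
      linarith
    · have h1 := (hρ.subpath a b).dist_left t
      have h2 := (hρ.subpath a b).dist_right t
      have h3 := (hτ.subpath a' b').dist_left t
      have h4 := (hτ.subpath a' b').dist_right t
      generalize (τ.subpath a' b') t = z at h3 h4 ⊢
      rw [ha', hb'] at h3
      rw [ha', hb'] at h4
      have := dist_le_of_proportional t.2.1 t.2.2 h1 h2 h3 h4
      rw [dist_self] at this
      exact dist_le_zero.1 this

/-- In a nontrivial simplicial tree, the points which are not vertices are dense. -/
theorem IsSimplicial.dense_compl [Nontrivial T] {V : Set T} (hV : IsSimplicial V) :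
    Dense Vᶜ := by
  intro v
  obtain ⟨w, hw⟩ := exists_ne v
  obtain ⟨τ, hτ⟩ := IsRTree.exists_geodesic v w
  have hpos : 0 < dist v w := dist_pos.2 hw.symm
  -- By injectivity the geodesic from `v` meets `V` at finitely many parameters, so `0` is a limit
  -- of the others.
  have hinj : Function.Injective τ := fun s t hst => by
    have h := hτ s t
    rw [hst, dist_self, eq_comm, mul_eq_zero, or_iff_right hpos.ne', abs_eq_zero,
      sub_eq_zero] at h
    exact Subtype.ext h
  have hfin : (τ ⁻¹' V).Finite := by
    refine ((hV.finite_seg v w).preimage hinj.injOn).subset fun t ht => ⟨?_, ht⟩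
    change dist v (τ t) + dist (τ t) w = dist v w
    rw [hτ.dist_left, hτ.dist_right]
    ring
  have hd : Dense (τ ⁻¹' V)ᶜ := by
    simpa [Set.compl_eq_univ_sdiff] using (dense_univ (X := I)).sdiff_finite hfin
  have h0 := map_mem_closure (t := Vᶜ) τ.continuous (hd 0) fun t ht => ht
  rwa [Path.source] at h0

end RTree

/-- Two `𝒪`-maps between the same trees are at bounded distance. -/
theorem OMap.exists_dist_le {G : Type u} [Group G] {q : ℕ} {H : Fin q → Subgroup G}
    {A : OuterTree.{u, v} G H} {B : OuterTree.{u, w} G H} (f h : OMap A B) :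
    ∃ D : ℝ, ∀ z, dist (f.toFun z) (h.toFun z) ≤ D := by
  -- For a one-point tree density of the non-vertices may fail.
  rcases subsingleton_or_nontrivial A.carrier with hA | hA
  · obtain ⟨o⟩ := IsRTree.nonempty (T := A.carrier)
    exact ⟨dist (f.toFun o) (h.toFun o), fun z => by rw [Subsingleton.elim z o]⟩
  · obtain ⟨E, hE, hEdge⟩ := A.finite_quotient
    obtain ⟨K, hK⟩ := f.lipschitz
    obtain ⟨K', hK'⟩ := h.lipschitz
    obtain ⟨D, hD⟩ := (hE.image fun p => K * dist p.1 p.2 + dist (f.toFun p.1) (h.toFun p.1) +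
      K' * dist p.1 p.2).bddAbove
    refine ⟨D, fun z => ?_⟩
    -- The bound is a closed condition, so it need only be checked at non-vertices, each of which
    -- lies on an edge.
    have hclosed : IsClosed {z | dist (f.toFun z) (h.toFun z) ≤ D} :=
      isClosed_le (f.continuous.dist h.continuous) continuous_const
    refine hclosed.closure_subset_iff.2 (fun z hz => ?_) (A.simplicial.dense_compl z)
    obtain ⟨u, v, huv, hzuv⟩ := A.simplicial.exists_edge z hz
    obtain ⟨g, hg⟩ := hEdge u v huv
    have hle : dist (g • z) (g • u) ≤ dist (g • u) (g • v) := by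
      have e : dist u z + dist z v = dist u v := hzuv
      rw [dist_smul, dist_smul, dist_comm]
      linarith [dist_nonneg (x := z) (y := v)]
    have hb := hD (Set.mem_image_of_mem _ hg)
    have e1 : dist (f.toFun (g • z)) (f.toFun (g • u)) ≤ K * dist (g • u) (g • v) :=
      (hK.dist_le_mul _ _).trans (mul_le_mul_of_nonneg_left hle K.2)
    have e2 : dist (h.toFun (g • z)) (h.toFun (g • u)) ≤ K' * dist (g • u) (g • v) :=
      (hK'.dist_le_mul _ _).trans (mul_le_mul_of_nonneg_left hle K'.2)
    have e3 : dist (f.toFun (g • z)) (h.toFun (g • z)) = dist (f.toFun z) (h.toFun z) := by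
      rw [f.equivariant, h.equivariant, dist_smul]
    have t1 := dist_triangle4 (f.toFun (g • z)) (f.toFun (g • u)) (h.toFun (g • u))
      (h.toFun (g • z))
    rw [dist_comm (h.toFun (g • u)) (h.toFun (g • z))] at t1
    change dist (f.toFun z) (h.toFun z) ≤ D
    dsimp only at hb
    linarith

end RelOuterSpace

theorem mainTheorem7 {G : Type u} [Group G] {q r : ℕ} (hr : 0 < r)
    (H : Fin q → Subgroup G) (b : Fin r → G)
    (hdec : RelOuterSpace.IsFreeProductDecomposition H b)
    (A : RelOuterSpace.OuterTree.{u, v} G H) (B : RelOuterSpace.OuterTree.{u, w} G H)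
    (f h : RelOuterSpace.OMap A B) :
    ∃ C : ℝ, 0 < C ∧ ∀ (x y : A.carrier) (L : Path x y),
      RelOuterSpace.EqualExceptNearEnds C
        (RelOuterSpace.tighten (L.map f.continuous))
        (RelOuterSpace.tighten (L.map h.continuous)) := by
  obtain ⟨D, hD⟩ := f.exists_dist_le h
  have hpos : 0 < max D 1 := lt_max_of_lt_right one_pos
  exact ⟨6 * max D 1, by positivity, fun x y L =>
    (RelOuterSpace.isTightening_tighten _).2.equalExceptNearEnds
      (RelOuterSpace.isTightening_tighten _).2 hpos
      ((hD x).trans (le_max_left _ _)) ((hD y).trans (le_max_left _ _))⟩
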